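/- Let $X$ be a standard Borel space and let $E$ be a countable Borel equivalence relation on $X$, that is, an equivalence relation that is a Borel subset of $X\times X$ and all of whose classes are countable. A Borel cocycle is a Borel function $\rho\colon E\to(0,\infty)$ with $\rho(x,z)=\rho(x,y)\,\rho(y,z)$ whenever $x\mathrel{E}y\mathrel{E}z$. It is called smooth if there are an open neighborhood $U\subseteq(0,\infty)$ of $1$ and a Borel function $c\colon X\to\mathbb{N}$ such that $c(x)\neq c(y)$ for all distinct $E$-equivalent points $x,y$ with $\rho(x,y)\in U$. For a subset $Y$ of an $E$-class and a point $z$ of that class, put $|Y|^\rho_z=\sum_{y\in Y}\rho(y,z)\in[0,\infty]$. A compression of $\rho$ is a function $\phi\colon X\to X$ such that $x\mathrel{E}\phi(x)$ for all $x\in X$, $|\phi^{-1}(\{x\})|^\rho_x\le 1$ for all $x\in X$, and the set $\{x\in X: |\phi^{-1}(\{x\})|^\rho_x<1\}$ meets every $E$-class. If $F\subseteq E$ is a finite Borel equivalence relation on $X$ (a Borel equivalence relation all of whose classes are finite), then $X/F$ carries the quotient Borel structure, $E/F$ is the equivalence relation on $X/F$ relating two $F$-classes when they are contained in the same $E$-class,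 and the quotient of $\rho$ by $F$ is the cocycle $\rho/F\colon E/F\to(0,\infty)$ given by $(\rho/F)([x]_F,[y]_F)=|[x]_F|^\rho_z/|[y]_F|^\rho_z$, which does not depend on the choice of the point $z$ in the $E$-class of $x$ and $y$; compressions of $\rho/F$ are defined as above, with $X/F$, $E/F$, $\rho/F$ in place of $X$, $E$, $\rho$. A Borel measure $\mu$ on $X$ is $\rho$-invariant if $\mu(T(B))=\int_B\rho(T(x),x)\,d\mu(x)$ for all Borel sets $B\subseteq X$ and all Borel automorphisms $T\colon X\to X$ whose graphs are contained in $E$. Proposition. Suppose that $X$ is a standard Borel space, $E$ is a countable Borel equivalence relation on $X$, and $\rho\colon E\to(0,\infty)$ is a smooth Borel cocycle. Then exactly one of the following holds: (1) There are a finite Borel equivalence relation $F\subseteq E$ on $X$ and an injective Borel function $\phi\colon X/F\to X/F$ that is a compression of $\rho/F$. (2) There is a $\rho$-invariant Borel probability measure on $X$. -/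

import Mathlib

open MeasureTheory
open scoped ENNReal

namespace CocycleInvariance

/-- `E` is a countable Borel equivalence relation: it is a Borel subset of `X × X` and all of its
classes are countable. -/
structure IsCountableBorel {X : Type*} [MeasurableSpace X] (E : Setoid X) : Prop where
  measurableSet : MeasurableSet {p : X × X | E p.1 p.2}
  countable_classes : ∀ x, {y | E x y}.Countable

/-- `F` is a finite Borel equivalence relation: it is a Borel subset of `X × X` and all of its
classes are finite. -/
structure IsFiniteBorel {X : Type*} [MeasurableSpace X] (F : Setoid X) : Prop where
  measurableSet : MeasurableSet {p : X × X | F p.1 p.2}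
  finite_classes : ∀ x, {y | F x y}.Finite

/-- The restriction of `ρ` to `E` is a Borel cocycle `E → (0, ∞)`. A function on `E` is represented
by an arbitrary extension of it to all pairs; only its values on `E` are ever used. -/
structure IsBorelCocycle {X : Type*} [MeasurableSpace X] (E : Setoid X) (ρ : X → X → ℝ) :
    Prop where
  pos : ∀ x y, E x y → 0 < ρ x y
  mul : ∀ x y z, E x y → E y z → ρ x z = ρ x y * ρ y z
  measurable : Measurable fun p : {p : X × X // E p.1 p.2} => ρ p.1.1 p.1.2

/-- The `ρ`-size `∑_{y ∈ Y} ρ(y, z)`, relative to the point `z`, of a subset `Y` of the class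
of `z`. -/
noncomputable def size {X : Type*} (ρ : X → X → ℝ) (Y : Set X) (z : X) : ℝ≥0∞ :=
  ∑' y : Y, ENNReal.ofReal (ρ y z)

/-- `Y` is `E`-complete: it meets every `E`-class. -/
def IsComplete {X : Type*} (E : Setoid X) (Y : Set X) : Prop :=
  ∀ x, ∃ y ∈ Y, E x y

/-- `φ : X → X` is a compression of the cocycle `ρ` on `E`. -/
structure IsCompression {X : Type*} (E : Setoid X) (ρ : X → X → ℝ) (φ : X → X) : Prop where
  graph_subset : ∀ x, E x (φ x)
  size_le : ∀ x, size ρ (φ ⁻¹' {x}) x ≤ 1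
  complete : IsComplete E {x | size ρ (φ ⁻¹' {x}) x < 1}

/-- The digraph on `X` relating distinct `E`-equivalent points `x`, `y` with `ρ(x, y) ∈ Z`. -/
def lacunarityGraph {X : Type*} (E : Setoid X) (ρ : X → X → ℝ) (Z : Set ℝ) (x y : X) : Prop :=
  x ≠ y ∧ E x y ∧ ρ x y ∈ Z

/-- The cocycle `ρ` is smooth: for some open neighborhood `U ⊆ (0, ∞)` of `1`, the digraph
`lacunarityGraph E ρ U` has a Borel `ℕ`-coloring. -/
def IsSmooth {X : Type*} [MeasurableSpace X] (E : Setoid X) (ρ : X → X → ℝ) : Prop :=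
  ∃ U : Set ℝ, IsOpen U ∧ U ⊆ Set.Ioi 0 ∧ 1 ∈ U ∧
    ∃ c : X → ℕ, Measurable c ∧ ∀ x y, lacunarityGraph E ρ U x y → c x ≠ c y

/-- For `F ⊆ E`, the equivalence relation `E / F` on `X / F`: two `F`-classes are related when
they lie in the same `E`-class. -/
def quotientRel {X : Type*} {F E : Setoid X} (h : F ≤ E) : Setoid (Quotient F) :=
  Setoid.ker (Setoid.map_of_le h)

/-- The quotient cocycle `ρ / F` on `X / F`: its value at the `F`-classes `c`, `d` in a common
`E`-class is the `ρ`-size of `c` relative to `d`, that is, `|c|_z / |d|_z` for any point `z` of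
that `E`-class; a point of `d` serves as `z`. -/
noncomputable def quotientCocycle {X : Type*} (F : Setoid X) (ρ : X → X → ℝ)
    (c d : Quotient F) : ℝ :=
  (size ρ {x | (Quotient.mk F x) = c} d.out / size ρ {x | (Quotient.mk F x) = d} d.out).toReal

/-- The Borel measure `μ` is `ρ`-invariant: `μ (T(B)) = ∫_B ρ(T(x), x) dμ(x)` for all Borel sets
`B` and all Borel automorphisms `T` of `X` whose graphs are contained in `E`. -/
def IsInvariant {X : Type*} [MeasurableSpace X] (E : Setoid X) (ρ : X → X → ℝ)
    (μ : Measure X) : Prop :=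
  ∀ T : X ≃ᵐ X, (∀ x, E x (T x)) → ∀ B : Set X, MeasurableSet B →
    μ (T '' B) = ∫⁻ x in B, ENNReal.ofReal (ρ (T x) x) ∂μ

/-- There is an injective Borel compression of the quotient of `ρ` by a finite Borel
subequivalence relation `F` of `E`; here `X / F` carries the quotient Borel structure. -/
def HasInjectiveBorelQuotientCompression {X : Type*} [MeasurableSpace X] (E : Setoid X)
    (ρ : X → X → ℝ) : Prop :=
  ∃ (F : Setoid X) (h : F ≤ E), IsFiniteBorel F ∧
    ∃ φ : Quotient F → Quotient F, Measurable φ ∧ Function.Injective φ ∧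
      IsCompression (quotientRel h) (quotientCocycle F ρ) φ

/-- There is a `ρ`-invariant Borel probability measure. -/
def HasInvariantProbability {X : Type*} [MeasurableSpace X] (E : Setoid X)
    (ρ : X → X → ℝ) : Prop :=
  ∃ μ : Measure X, IsProbabilityMeasure μ ∧ IsInvariant E ρ μ

end CocycleInvariance

namespace CocycleInvariance

variable {X : Type*} [MeasurableSpace X] {E : Setoid X} {ρ : X → X → ℝ}

/-! ### Cocycle identities and the Borel automorphisms covering `E` -/

namespace IsBorelCocycle

/-! Everything turns on whether some `E`-class has finite `ρ`-size. If one does, giving each of its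
points `y` mass `ρ(y, z)` and normalizing yields an invariant probability measure.

If all classes have infinite size, a compression is built from a lacunary complete Borel set `Y`,
obtained from smoothness: distinct equivalent points of `Y` have `|log ρ|` at least some `δ > 0`.
Where `Y` has a `ρ`-largest point in a class, lacunarity makes it unique. It serves as a base point
from which the class is cut into finite blocks of strictly increasing size, and each block is sent
to the next (`Generates.exists_blocks`). Where there is no largest point, lacunarity gives each
point of `Y` an immediate successor of strictly larger size (`exists_successor`); points of `Y` move
there and all others stay fixed. `F` consists of the blocks in the first case and is equality in the
second.

The alternatives exclude each other by mass transport (`IsInvariant.mass_transport`): each point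
spreads unit mass over the `F`-class that is the image of its own. Every point then receives at most
`1`, and points of a complete set receive less, whereas the totals sent and received agree.

Borel measurability rests on countably many Borel automorphisms covering `E`
(`exists_measurableEquiv_enumeration`), which reduce sums, saturations and choices within classes to
countable operations. -/

theorem self (hρ : IsBorelCocycle E ρ) (x : X) : ρ x x = 1 := by
  have h := hρ.mul x x x (E.refl x) (E.refl x)
  have := hρ.pos x x (E.refl x)
  nlinarith

theorem inv (hρ : IsBorelCocycle E ρ) {x y : X} (h : E x y) : ρ y x = (ρ x y)⁻¹ := by
  have h1 := hρ.mul x y x h (E.symm h)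
  rw [hρ.self] at h1
  exact eq_inv_of_mul_eq_one_right h1.symm

theorem comp (hρ : IsBorelCocycle E ρ) {α : Type*} [MeasurableSpace α] {f g : α → X}
    (hf : Measurable f) (hg : Measurable g) (h : ∀ a, E (f a) (g a)) :
    Measurable fun a => ρ (f a) (g a) :=
  hρ.measurable.comp ((hf.prodMk hg).subtype_mk (h := h))

theorem measurableSet_rel (hE : IsCountableBorel E) (hρ : IsBorelCocycle E ρ) {S : Set ℝ}
    (hS : MeasurableSet S) : MeasurableSet {p : X × X | E p.1 p.2 ∧ ρ p.2 p.1 ∈ S} := by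
  have h : MeasurableSet {p : {p : X × X // E p.1 p.2} | ρ p.1.2 p.1.1 ∈ S} :=
    hρ.comp (measurable_snd.comp measurable_subtype_coe)
      (measurable_fst.comp measurable_subtype_coe) (fun a => E.symm a.2) hS
  convert hE.measurableSet.subtype_image h using 1
  ext p
  simp [and_comm]

end IsBorelCocycle

/-- A smooth cocycle has a Borel colouring whose colour classes are uniformly lacunary. -/
theorem IsSmooth.exists_gap (hρ : IsBorelCocycle E ρ) (h : IsSmooth E ρ) :
    ∃ c : X → ℕ, Measurable c ∧ ∃ δ > 0, ∀ x y, E x y → c x = c y → x ≠ y →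
      δ ≤ |Real.log (ρ x y)| := by
  obtain ⟨U, hU, -, h1, c, hc, hcol⟩ := h
  have hV : Real.exp ⁻¹' U ∈ nhds (0 : ℝ) :=
    (hU.preimage Real.continuous_exp).mem_nhds (by simpa using h1)
  obtain ⟨δ, hδ, hball⟩ := Metric.mem_nhds_iff.1 hV
  refine ⟨c, hc, δ, hδ, fun x y hxy hcxy hne => ?_⟩
  by_contra! hlt
  refine hcol x y ⟨hne, hxy, ?_⟩ hcxy
  have := hball (a := Real.log (ρ x y)) (by simpa [Real.dist_eq] using hlt)
  simpa [Real.exp_log (hρ.pos x y hxy)] using this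

/-- A Borel subset of `E` all of whose vertical sections have at most one point is contained in
the graph of a Borel function. -/
theorem exists_measurable_of_subsingleton_sections [StandardBorelSpace X] {R : Set (X × X)}
    (hR : MeasurableSet R) (hRE : ∀ p ∈ R, E p.1 p.2)
    (hsub : ∀ x y z, (x, y) ∈ R → (x, z) ∈ R → y = z) :
    ∃ f : X → X, Measurable f ∧ (∀ x, E x (f x)) ∧ ∀ x y, (x, y) ∈ R → f x = y := by
  classical
  have key : ∀ x, ∃ y, E x y ∧ (∀ z, (x, z) ∈ R → y = z) ∧ ((∀ z, (x, z) ∉ R) → y = x) := by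
    intro x
    by_cases h : ∃ z, (x, z) ∈ R
    · obtain ⟨z, hz⟩ := h
      exact ⟨z, hRE _ hz, fun z' hz' => hsub x z z' hz hz', fun h => absurd hz (h z)⟩
    · push Not at h
      exact ⟨x, E.refl x, fun z hz => absurd hz (h z), fun _ => rfl⟩
  choose f hfE hf hf' using key
  refine ⟨f, ?_, hfE, hf⟩
  -- The first projection is injective on `R`, so Borel subsets of `R` have Borel projections
  -- (Lusin–Souslin).
  have himg : ∀ S : Set (X × X), MeasurableSet S → MeasurableSet (Prod.fst '' (R ∩ S)) := by
    intro S hS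
    refine (hR.inter hS).image_of_measurable_injOn measurable_fst ?_
    rintro ⟨a, b⟩ ⟨h, -⟩ ⟨a', b'⟩ ⟨h', -⟩ (rfl : a = a')
    rw [hsub a b b' h h']
  intro S hS
  have : f ⁻¹' S = Prod.fst '' (R ∩ Prod.snd ⁻¹' S) ∪ (S ∩ (Prod.fst '' (R ∩ Set.univ))ᶜ) := by
    ext x
    by_cases h : ∃ z, (x, z) ∈ R
    · obtain ⟨z, hz⟩ := h
      have := hf x z hz
      subst this
      constructor
      · intro hx
        exact Or.inl ⟨(x, f x), ⟨hz, hx⟩, rfl⟩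
      · rintro (⟨⟨a, b⟩, ⟨h1, h2⟩, rfl⟩ | ⟨-, h2⟩)
        · rw [hsub a b _ h1 hz] at h2
          exact h2
        · exact absurd ⟨(x, f x), ⟨hz, trivial⟩, rfl⟩ h2
    · push Not at h
      have hx := hf' x h
      simp [hx, h]
  rw [this]
  exact (himg _ (measurable_snd hS)).union (hS.inter (himg _ MeasurableSet.univ).compl)

/-- The classes of an equivalence relation admitting a smooth cocycle are enumerated by a
countable family of Borel functions. -/
theorem exists_measurable_enumeration [StandardBorelSpace X] (hE : IsCountableBorel E)
    (hρ : IsBorelCocycle E ρ) (h : IsSmooth E ρ) :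
    ∃ f : ℕ × ℤ → X → X, (∀ i, Measurable (f i)) ∧ (∀ i x, E x (f i x)) ∧
      ∀ x y, E x y → ∃ i, f i x = y := by
  obtain ⟨c, hc, δ, hδ, hgap⟩ := h.exists_gap hρ
  -- Index by the colour of `y` and the bucket of width `δ` containing `log ρ(y, x)`. Two points
  -- sharing both have `|log ρ| < δ` between them, so the gap forces them to coincide.
  let R : ℕ × ℤ → Set (X × X) := fun i =>
    {p | E p.1 p.2 ∧ ρ p.2 p.1 ∈ {v : ℝ | ⌊Real.log v / δ⌋ = i.2}} ∩ {p | c p.2 = i.1}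
  have hmeas : ∀ i, MeasurableSet (R i) := fun i =>
    (hρ.measurableSet_rel hE
      ((Int.measurable_floor.comp (Real.measurable_log.div_const δ))
        (measurableSet_singleton i.2))).inter
      ((hc.comp measurable_snd) (measurableSet_singleton i.1))
  have hsub : ∀ i x y z, (x, y) ∈ R i → (x, z) ∈ R i → y = z := by
    rintro i x y z ⟨⟨hxy, h1⟩, hcy⟩ ⟨⟨hxz, h2⟩, hcz⟩
    simp only [Set.mem_ofPred_eq] at h1 h2 hcy hcz hxy hxz
    by_contra hne
    have hyz : E y z := E.trans (E.symm hxy) hxz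
    have hg := hgap y z hyz (hcy.trans hcz.symm) hne
    have h3 := Int.abs_sub_lt_one_of_floor_eq_floor (h1.trans h2.symm)
    have h4 : Real.log (ρ y x) = Real.log (ρ y z) + Real.log (ρ z x) := by
      rw [hρ.mul y z x hyz (E.symm hxz), Real.log_mul (hρ.pos _ _ hyz).ne'
        (hρ.pos _ _ (E.symm hxz)).ne']
    rw [← sub_div, h4, add_sub_cancel_right, abs_div, abs_of_pos hδ, div_lt_one hδ] at h3
    exact absurd hg (not_le.2 h3)
  choose f hf1 hf2 hf3 using fun i =>
    exists_measurable_of_subsingleton_sections (E := E) (hmeas i) (fun p hp => hp.1.1) (hsub i)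
  refine ⟨f, hf1, hf2, fun x y hxy => ⟨(c y, ⌊Real.log (ρ y x) / δ⌋), hf3 _ x y ?_⟩⟩
  exact ⟨⟨hxy, rfl⟩, rfl⟩

/-- The involution exchanging `C` with its image under `f`, where `g` inverts `f` on `C`, is a
Borel automorphism. -/
theorem exists_measurableEquiv_swap {f g : X → X} (hf : Measurable f) (hg : Measurable g)
    (hfE : ∀ x, E x (f x)) (hgE : ∀ x, E x (g x)) {C : Set X} (hC : MeasurableSet C)
    (hfg : ∀ x ∈ C, g (f x) = x) (hdisj : ∀ x ∈ C, f x ∉ C)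
    (heq : MeasurableSet {x | f (g x) = x}) :
    ∃ T : X ≃ᵐ X, (∀ x, E x (T x)) ∧ ∀ x ∈ C, T x = f x := by
  classical
  let D : Set X := {x | g x ∈ C ∧ f (g x) = x}
  have hD : MeasurableSet D := (hg hC).inter heq
  let T : X → X := fun x => if x ∈ C then f x else if x ∈ D then g x else x
  have hT : Measurable T := Measurable.ite hC hf (Measurable.ite hD hg measurable_id)
  have hTC : ∀ x ∈ C, T x = f x := fun x hx => if_pos hx
  have hCD : ∀ x ∈ C, f x ∈ D := fun x hx => by
    simp only [D, Set.mem_ofPred_eq, hfg x hx, hx, and_self]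
  have hDC : ∀ x ∈ D, x ∉ C := fun x hx hxC => by
    have := hdisj _ hx.1
    rw [hx.2] at this
    exact this hxC
  have hTD : ∀ x ∈ D, T x = g x := fun x hx => by
    simp only [T, if_neg (hDC x hx), if_pos hx]
  have hTT : ∀ x, T (T x) = x := by
    intro x
    by_cases hx : x ∈ C
    · rw [hTC x hx, hTD _ (hCD x hx), hfg x hx]
    · by_cases hx' : x ∈ D
      · rw [hTD x hx', hTC _ hx'.1, hx'.2]
      · have : T x = x := by simp only [T, if_neg hx, if_neg hx']
        rw [this, this]
  refine ⟨⟨⟨T, T, hTT, hTT⟩, hT, hT⟩, fun x => ?_, hTC⟩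
  change E x (T x)
  simp only [T]
  split_ifs
  exacts [hfE x, hgE x, E.refl x]

/-- An equivalence relation admitting a smooth cocycle is covered by the graphs of countably many
Borel automorphisms. -/
theorem exists_measurableEquiv_enumeration [StandardBorelSpace X] (hE : IsCountableBorel E)
    (hρ : IsBorelCocycle E ρ) (h : IsSmooth E ρ) :
    ∃ T : ℕ → X ≃ᵐ X, (∀ i x, E x (T i x)) ∧ ∀ x y, E x y → ∃ i, T i x = y := by
  obtain ⟨f, hf, hfE, hfs⟩ := exists_measurable_enumeration hE hρ h
  obtain ⟨e, he⟩ := MeasureTheory.exists_measurableEmbedding_real X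
  -- The second function inverts the first on `C i`, and a rational separates `x` from its image
  -- under the real embedding, on a side fixed by the Boolean. Hence `C i` is disjoint from its
  -- image.
  let C : (ℕ × ℤ) × (ℕ × ℤ) × ℚ × Bool → Set X := fun i =>
    {x | f i.2.1 (f i.1 x) = x} ∩
      if i.2.2.2 then {x | e x < i.2.2.1} ∩ {x | (i.2.2.1 : ℝ) < e (f i.1 x)}
      else {x | (i.2.2.1 : ℝ) < e x} ∩ {x | e (f i.1 x) < i.2.2.1}
  have hC : ∀ i, MeasurableSet (C i) := by
    intro i
    refine (measurableSet_eq_fun ((hf _).comp (hf _)) measurable_id).inter ?_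
    have h1 := he.measurable
    have h2 := he.measurable.comp (hf i.1)
    split_ifs
    · exact (measurableSet_lt h1 measurable_const).inter (measurableSet_lt measurable_const h2)
    · exact (measurableSet_lt measurable_const h1).inter (measurableSet_lt h2 measurable_const)
  have key : ∀ i, ∃ T : X ≃ᵐ X, (∀ x, E x (T x)) ∧ ∀ x ∈ C i, T x = f i.1 x := by
    intro i
    refine exists_measurableEquiv_swap (hf i.1) (hf i.2.1) (hfE _) (hfE _) (hC i)
      (fun x hx => hx.1) ?_ (measurableSet_eq_fun ((hf _).comp (hf _)) measurable_id)
    rintro x ⟨-, hx⟩ ⟨-, hx'⟩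
    split_ifs at hx hx' <;>
      simp only [Set.mem_inter_iff, Set.mem_ofPred_eq] at hx hx'
    · exact lt_asymm hx.2 hx'.1
    · exact lt_asymm hx.2 hx'.1
  choose T hTE hTC using key
  -- `none` stands for the identity, needed for the diagonal, where no rational separates.
  obtain ⟨s, hs⟩ := exists_surjective_nat (Option ((ℕ × ℤ) × (ℕ × ℤ) × ℚ × Bool))
  refine ⟨fun n => (s n).elim (MeasurableEquiv.refl X) T, fun n x => ?_, fun x y hxy => ?_⟩
  · cases h : s n with
    | none => simp [h]
    | some i => simpa [h] using hTE i x
  · obtain rfl | hne := eq_or_ne x y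
    · obtain ⟨n, hn⟩ := hs none
      exact ⟨n, by simp [hn]⟩
    · obtain ⟨i, hi⟩ := hfs x y hxy
      obtain ⟨j, hj⟩ := hfs y x (E.symm hxy)
      have : ∃ q b, x ∈ C (i, j, q, b) := by
        rcases lt_or_gt_of_ne (he.injective.ne hne) with hlt | hlt
        · obtain ⟨q, h1, h2⟩ := exists_rat_btwn hlt
          exact ⟨q, true, by simp [C, hi, hj, h1, h2]⟩
        · obtain ⟨q, h1, h2⟩ := exists_rat_btwn hlt
          exact ⟨q, false, by simp [C, hi, hj, h1, h2]⟩
      obtain ⟨q, b, hx⟩ := this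
      obtain ⟨n, hn⟩ := hs (some (i, j, q, b))
      exact ⟨n, by simp [hn, hTC _ x hx, hi]⟩

end CocycleInvariance

namespace CocycleInvariance

variable {X : Type*} {E F : Setoid X} {ρ : X → X → ℝ}

/-! ### Sizes -/

theorem size_mono (ρ : X → X → ℝ) {Y Y' : Set X} (h : Y ⊆ Y') (z : X) :
    size ρ Y z ≤ size ρ Y' z :=
  ENNReal.tsum_mono_subtype (fun y => ENNReal.ofReal (ρ y z)) h

theorem size_singleton (ρ : X → X → ℝ) (x z : X) :
    size ρ {x} z = ENNReal.ofReal (ρ x z) :=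
  tsum_singleton x fun y => ENNReal.ofReal (ρ y z)

theorem size_ne_top (ρ : X → X → ℝ) {Y : Set X} (hY : Y.Finite) (z : X) : size ρ Y z ≠ ∞ := by
  have := hY.fintype
  rw [size, tsum_fintype]
  exact ENNReal.sum_ne_top.2 fun _ _ => ENNReal.ofReal_ne_top

theorem setOf_mk_eq (F : Setoid X) (x : X) :
    {z | Quotient.mk F z = Quotient.mk F x} = {z | F z x} := by
  ext z
  exact Quotient.eq

theorem quotientRel_mk {h : F ≤ E} {x y : X} :
    quotientRel h (Quotient.mk F x) (Quotient.mk F y) ↔ E x y := by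
  rw [quotientRel, Setoid.ker_def]
  exact Quotient.eq

theorem tsum_class_eq {x : X} (P : ℕ → Prop) [DecidablePred P] (p : ℕ → X)
    (hp : ∀ i, P i → E x (p i)) (hex : ∀ y, E x y → ∃ i, P i ∧ p i = y)
    (huniq : ∀ i j, P i → P j → p i = p j → i = j) (u : X → ℝ≥0∞) :
    ∑' y : {y // E x y}, u y = ∑' i, if P i then u (p i) else 0 := by
  choose! j hj using hex
  have hinj : Function.Injective fun y : {y // E x y} => j y := by
    intro y y' hyy
    have h1 := (hj y y.2).2
    have h2 := (hj y' y'.2).2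
    simp only at hyy
    rw [hyy] at h1
    exact Subtype.ext (h1.symm.trans h2)
  rw [← hinj.tsum_eq (f := fun i => if P i then u (p i) else 0)]
  · refine tsum_congr fun y => ?_
    simp [(hj y y.2).1, (hj y y.2).2]
  · intro i hi
    have hPi : P i := by
      by_contra hPi
      simp [hPi] at hi
    have h := hj (p i) (hp i hPi)
    exact ⟨⟨p i, hp i hPi⟩, huniq _ _ h.1 hPi h.2⟩

theorem tsum_subtype_ite {p q : X → Prop} [DecidablePred q] (hqp : ∀ x, q x → p x)
    (u : X → ℝ≥0∞) :
    ∑' x : {x // p x}, (if q x then u x else 0) = ∑' x : {x | q x}, u x := by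
  have h1 := tsum_subtype {x | p x} fun x => if q x then u x else 0
  have h2 := tsum_subtype {x | q x} u
  rw [h2]
  refine h1.trans (tsum_congr fun x => ?_)
  by_cases hx : q x
  · simp [hx, hqp x hx]
  · simp [hx]

variable [MeasurableSpace X]

theorem size_change_base (hρ : IsBorelCocycle E ρ) {Y : Set X} {z z' : X}
    (hY : ∀ y ∈ Y, E y z) (h : E z z') :
    size ρ Y z' = size ρ Y z * ENNReal.ofReal (ρ z z') := by
  rw [size, size, ← ENNReal.tsum_mul_right]
  refine tsum_congr fun y => ?_
  rw [hρ.mul y z z' (hY y y.2) h, ENNReal.ofReal_mul (hρ.pos _ _ (hY y y.2)).le]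

theorem size_ne_zero (hρ : IsBorelCocycle E ρ) {Y : Set X} {y z : X} (hy : y ∈ Y) (h : E y z) :
    size ρ Y z ≠ 0 := by
  refine ne_of_gt (lt_of_lt_of_le ?_ (size_mono ρ (Set.singleton_subset_iff.2 hy) z))
  rw [size_singleton]
  exact ENNReal.ofReal_pos.2 (hρ.pos _ _ h)

theorem IsFiniteBorel.finite_fiber (hF : IsFiniteBorel F) (x : X) : {z | F z x}.Finite := by
  convert hF.finite_classes x using 3
  exact ⟨F.symm, F.symm⟩

/-- The quotient cocycle is a ratio of sizes computed at any point of the ambient class. -/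
theorem ofReal_quotientCocycle (hρ : IsBorelCocycle E ρ) (h : F ≤ E) (hF : IsFiniteBorel F)
    {x y z : X} (hxz : E x z) (hyz : E y z) :
    ENNReal.ofReal (quotientCocycle F ρ (Quotient.mk F x) (Quotient.mk F y)) =
      size ρ {w | F w x} z / size ρ {w | F w y} z := by
  have ho : F (Quotient.mk F y).out y := Quotient.mk_out y
  set o := (Quotient.mk F y).out with ho'
  have hoz : E o z := E.trans (h ho) hyz
  rw [quotientCocycle, setOf_mk_eq, setOf_mk_eq, ← ho']
  have h1 : size ρ {w | F w x} z = size ρ {w | F w x} o * ENNReal.ofReal (ρ o z) :=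
    size_change_base hρ (fun w hw => E.trans (h hw) (E.trans hxz (E.symm hoz))) hoz
  have h2 : size ρ {w | F w y} z = size ρ {w | F w y} o * ENNReal.ofReal (ρ o z) :=
    size_change_base hρ (fun w hw => E.trans (h hw) (E.trans hyz (E.symm hoz))) hoz
  have h3 : size ρ {w | F w y} o ≠ 0 :=
    size_ne_zero hρ (Set.mem_ofPred_eq ▸ F.refl y) (E.trans hyz (E.symm hoz))
  rw [ENNReal.ofReal_toReal (ENNReal.div_ne_top (size_ne_top ρ (hF.finite_fiber x) o) h3), h1, h2]
  exact (ENNReal.mul_div_mul_right _ _ (ENNReal.ofReal_pos.2 (hρ.pos _ _ hoz)).ne'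
    ENNReal.ofReal_ne_top).symm

theorem size_quotientCocycle (hρ : IsBorelCocycle E ρ) (h : F ≤ E) (hF : IsFiniteBorel F)
    {φ : Quotient F → Quotient F} (hinj : Function.Injective φ)
    (hφ : ∀ c, quotientRel h c (φ c)) (y : X) :
    size (quotientCocycle F ρ) (φ ⁻¹' {Quotient.mk F y}) (Quotient.mk F y) =
      size ρ {x | φ (Quotient.mk F x) = Quotient.mk F y} y / size ρ {w | F w y} y := by
  by_cases hd : ∃ d, φ d = Quotient.mk F y
  · obtain ⟨d, hd⟩ := hd
    obtain ⟨x, rfl⟩ := Quotient.exists_rep d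
    have hxy : E x y := by
      have := hφ (Quotient.mk F x)
      rw [hd] at this
      exact quotientRel_mk.1 this
    have h1 : φ ⁻¹' {Quotient.mk F y} = {Quotient.mk F x} := by
      ext c
      rw [Set.mem_preimage, Set.mem_singleton_iff, Set.mem_singleton_iff, ← hd, hinj.eq_iff]
    have h2 : {x | φ (Quotient.mk F x) = Quotient.mk F y} = {w | F w x} := by
      rw [← setOf_mk_eq]
      ext w
      rw [Set.mem_ofPred_eq, Set.mem_ofPred_eq, ← hd, hinj.eq_iff]
    rw [h1, h2, size, tsum_singleton (Quotient.mk F x)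
      (fun c => ENNReal.ofReal (quotientCocycle F ρ c (Quotient.mk F y))),
      ofReal_quotientCocycle hρ h hF hxy (E.refl y)]
  · push Not at hd
    have h1 : φ ⁻¹' {Quotient.mk F y} = ∅ := by
      ext c
      simpa using hd c
    have h2 : {x | φ (Quotient.mk F x) = Quotient.mk F y} = ∅ := by
      ext x
      simpa using hd _
    rw [h1, h2]
    simp [size]

/-! ### Sums over classes -/

/-- The functions on an equivalence relation that are Borel along pairs of Borel functions. -/
def MeasurableOn (E : Setoid X) (u : X → X → ℝ≥0∞) : Prop :=
  ∀ f g : X → X, Measurable f → Measurable g → (∀ x, E (f x) (g x)) →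
    Measurable fun x => u (f x) (g x)

/-- A countable family of Borel automorphisms whose graphs cover an equivalence relation. -/
structure Generates (E : Setoid X) (T : ℕ → X ≃ᵐ X) : Prop where
  rel : ∀ i x, E x (T i x)
  exists_eq : ∀ x y, E x y → ∃ i, T i x = y

namespace Generates

variable {T : ℕ → X ≃ᵐ X}

theorem rel_symm (hT : Generates E T) (i : ℕ) (x : X) : E x ((T i).symm x) := by
  have := hT.rel i ((T i).symm x)
  rw [MeasurableEquiv.apply_symm_apply] at this
  exact E.symm this

-- Each `y` is counted once, at the first index `i` with `T i x = y`.
open scoped Classical in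
theorem tsum_right (hT : Generates E T) (u : X → ℝ≥0∞) (x : X) :
    ∑' y : {y // E x y}, u y = ∑' i, if ∀ j < i, T j x ≠ T i x then u (T i x) else 0 := by
  refine tsum_class_eq (fun i => ∀ j < i, T j x ≠ T i x) (fun i => T i x) (fun i _ => hT.rel i x)
    (fun y hy => ?_) (fun i j hi hj h => ?_) u
  · have hex := hT.exists_eq x y hy
    refine ⟨Nat.find hex, fun j hj => ?_, Nat.find_spec hex⟩
    rw [Nat.find_spec hex]
    exact Nat.find_min hex hj
  · rcases lt_trichotomy i j with hlt | rfl | hlt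
    exacts [absurd h (hj i hlt), rfl, absurd h.symm (hi j hlt)]

-- The pair `(x, y)` gets the same index as in `tsum_right`, the first `i` with `T i x = y`, though
-- the sum now runs over `x`. This lets mass transport match terms index by index.
open scoped Classical in
theorem tsum_left (hT : Generates E T) (u : X → ℝ≥0∞) (y : X) :
    ∑' x : {x // E y x}, u x =
      ∑' i, if ∀ j < i, T j ((T i).symm y) ≠ T i ((T i).symm y) then u ((T i).symm y) else 0 := by
  refine tsum_class_eq (fun i => ∀ j < i, T j ((T i).symm y) ≠ T i ((T i).symm y))
    (fun i => (T i).symm y) (fun i _ => hT.rel_symm i y)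
    (fun x hx => ?_) (fun i j hi hj h => ?_) u
  · have hex := hT.exists_eq x y (E.symm hx)
    have h1 := Nat.find_spec hex
    have h2 : (T (Nat.find hex)).symm y = x := by
      rw [MeasurableEquiv.symm_apply_eq, h1]
    refine ⟨Nat.find hex, fun j hj => ?_, h2⟩
    rw [h2, h1]
    exact Nat.find_min hex hj
  · rcases lt_trichotomy i j with hlt | rfl | hlt
    · refine absurd ?_ (hj i hlt)
      rw [← h, MeasurableEquiv.apply_symm_apply, h, MeasurableEquiv.apply_symm_apply]
    · rfl
    · refine absurd ?_ (hi j hlt)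
      rw [h, MeasurableEquiv.apply_symm_apply, ← h, MeasurableEquiv.apply_symm_apply]

theorem measurableSet_first [StandardBorelSpace X] (T : ℕ → X ≃ᵐ X) (i : ℕ) :
    MeasurableSet {x | ∀ j < i, T j x ≠ T i x} := by
  have : {x | ∀ j < i, T j x ≠ T i x} = ⋂ j, ⋂ (_ : j < i), {x | T j x = T i x}ᶜ := by
    ext x
    simp
  rw [this]
  exact MeasurableSet.iInter fun j => MeasurableSet.iInter fun _ =>
    (measurableSet_eq_fun (T j).measurable (T i).measurable).compl

theorem measurable_tsum [StandardBorelSpace X] (hT : Generates E T) {u : X → X → ℝ≥0∞}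
    (hu : MeasurableOn E u) : Measurable fun y => ∑' x : {x // E y x}, u x y := by
  classical
  simp_rw [fun y => hT.tsum_right (fun x => u x y) y]
  refine Measurable.tsum fun i => Measurable.ite (measurableSet_first T i) ?_ measurable_const
  exact hu _ _ (T i).measurable measurable_id fun x => E.symm (hT.rel i x)

/-- Saturations of Borel relations are Borel. -/
theorem measurableSet_exists (hT : Generates E T) {P : X → X → Prop}
    (hP : ∀ i, MeasurableSet {x | P x (T i x)}) : MeasurableSet {x | ∃ y, E x y ∧ P x y} := by
  have : {x | ∃ y, E x y ∧ P x y} = ⋃ i, {x | P x (T i x)} := by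
    ext x
    simp only [Set.mem_ofPred_eq, Set.mem_iUnion]
    constructor
    · rintro ⟨y, hxy, h⟩
      obtain ⟨i, rfl⟩ := hT.exists_eq x y hxy
      exact ⟨i, h⟩
    · rintro ⟨i, h⟩
      exact ⟨_, hT.rel i x, h⟩
  rw [this]
  exact MeasurableSet.iUnion hP

end Generates

/-! ### Mass transport -/

theorem IsInvariant.lintegral_eq (hρ : IsBorelCocycle E ρ) {μ : Measure X}
    (hμ : IsInvariant E ρ μ) (T : X ≃ᵐ X) (hT : ∀ x, E x (T x)) {v : X → ℝ≥0∞}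
    (hv : Measurable v) :
    ∫⁻ x, v x ∂μ = ∫⁻ x, v (T x) * ENNReal.ofReal (ρ (T x) x) ∂μ := by
  have hd : Measurable fun x => ENNReal.ofReal (ρ (T x) x) :=
    (hρ.comp T.measurable measurable_id fun x => E.symm (hT x)).ennreal_ofReal
  -- Invariance, applied to preimages under `T`, says that `μ` is the pushforward of its `ρ(T x,
  -- x)`-weighting.
  have : μ = (μ.withDensity fun x => ENNReal.ofReal (ρ (T x) x)).map T := by
    ext S hS
    rw [Measure.map_apply T.measurable hS, withDensity_apply _ (T.measurable hS),
      ← hμ T hT _ (T.measurable hS), Set.image_preimage_eq _ T.surjective]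
  conv_lhs => rw [this]
  rw [lintegral_map hv T.measurable,
    lintegral_withDensity_eq_lintegral_mul _ hd (g := fun x => v (T x)) (hv.comp T.measurable)]
  refine lintegral_congr fun x => ?_
  simp [mul_comm]

/-- Both sides split into sums over the automorphisms, and the `i`-th terms agree by the change of
variables `y = T i x`. -/
theorem IsInvariant.mass_transport [StandardBorelSpace X] (hρ : IsBorelCocycle E ρ)
    {T : ℕ → X ≃ᵐ X} (hT : Generates E T) {μ : Measure X} (hμ : IsInvariant E ρ μ)
    {u : X → X → ℝ≥0∞} (hu : MeasurableOn E u) :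
    ∫⁻ x, ∑' y : {y // E x y}, u x y * ENNReal.ofReal (ρ y x) ∂μ =
      ∫⁻ y, ∑' x : {x // E y x}, u x y ∂μ := by
  classical
  simp_rw [fun x => hT.tsum_right (fun y => u x y * ENNReal.ofReal (ρ y x)) x,
    fun y => hT.tsum_left (fun x => u x y) y]
  have h1 : ∀ i, Measurable fun x => u x (T i x) := fun i =>
    hu _ _ measurable_id (T i).measurable (hT.rel i)
  have h2 : ∀ i, Measurable fun y => u ((T i).symm y) y := fun i =>
    hu _ _ (T i).symm.measurable measurable_id fun y => E.symm (hT.rel_symm i y)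
  have h3 : ∀ i, Measurable fun y =>
      if ∀ j < i, T j ((T i).symm y) ≠ T i ((T i).symm y) then u ((T i).symm y) y else 0 :=
    fun i => Measurable.ite ((T i).symm.measurable (Generates.measurableSet_first T i)) (h2 i)
      measurable_const
  rw [lintegral_tsum, lintegral_tsum]
  · refine tsum_congr fun i => ?_
    rw [hμ.lintegral_eq hρ (T i) (hT.rel i) (h3 i)]
    refine lintegral_congr fun x => ?_
    simp only [MeasurableEquiv.symm_apply_apply]
    split_ifs <;> simp
  · exact fun i => (h3 i).aemeasurable
  · refine fun i => (Measurable.ite (Generates.measurableSet_first T i) ?_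
      measurable_const).aemeasurable
    exact (h1 i).mul
      (hρ.comp (T i).measurable measurable_id fun x => E.symm (hT.rel i x)).ennreal_ofReal

/-! ### Incompatibility of compressions and invariant probability measures -/

/-- Countably many Borel sets separate the points of `X / F`, so equality there is a countable
conjunction of Borel conditions. -/
theorem IsFiniteBorel.measurableSet_graph [StandardBorelSpace X] {T : ℕ → X ≃ᵐ X}
    (hT : Generates E T) (h : F ≤ E) (hF : IsFiniteBorel F) {φ : Quotient F → Quotient F}
    (hφ : Measurable φ) {f g : X → X} (hf : Measurable f) (hg : Measurable g) :
    MeasurableSet {x | φ (Quotient.mk F (f x)) = Quotient.mk F (g x)} := by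
  obtain ⟨e, he⟩ := MeasureTheory.exists_measurableEmbedding_real X
  -- Since `F`-classes are finite, each has an `e`-least point. The sets `S q` determine its value,
  -- hence the class.
  let S : ℚ → Set (Quotient F) := fun q => {c | ∃ y, Quotient.mk F y = c ∧ e y < q}
  have hmk : Measurable (Quotient.mk F) := measurable_quotient_mk''
  have hS : ∀ q, MeasurableSet (S q) := by
    intro q
    rw [measurableSet_quotient]
    have : (Quotient.mk'' : X → Quotient F) ⁻¹' S q = {x | ∃ y, E x y ∧ (F x y ∧ e y < q)} := by
      ext x
      constructor
      · rintro ⟨y, hy, hq⟩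
        have : F x y := F.symm (Quotient.eq.1 hy)
        exact ⟨y, h this, this, hq⟩
      · rintro ⟨y, -, hy, hq⟩
        exact ⟨y, Quotient.eq.2 (F.symm hy), hq⟩
    rw [this]
    refine hT.measurableSet_exists fun i => ?_
    exact ((measurable_id.prodMk (T i).measurable) hF.measurableSet).inter
      (measurableSet_lt (he.measurable.comp (T i).measurable) measurable_const)
  have hsep : ∀ c d : Quotient F, (∀ q, c ∈ S q ↔ d ∈ S q) → c = d := by
    have hmin : ∀ c : Quotient F, ∃ y, Quotient.mk F y = c ∧
        ∀ z, Quotient.mk F z = c → e y ≤ e z := by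
      intro c
      obtain ⟨x, rfl⟩ := Quotient.exists_rep c
      have hfin : {z | Quotient.mk F z = Quotient.mk F x}.Finite := by
        rw [setOf_mk_eq]
        exact hF.finite_fiber x
      obtain ⟨y, hy, hy'⟩ := Set.exists_min_image _ e hfin ⟨x, rfl⟩
      exact ⟨y, hy, hy'⟩
    have hle : ∀ c d y z, Quotient.mk F y = c → (∀ w, Quotient.mk F w = d → e z ≤ e w) →
        (∀ q, c ∈ S q ↔ d ∈ S q) → e z ≤ e y := by
      intro c d y z hy hz hcd
      by_contra! hlt
      obtain ⟨q, h1, h2⟩ := exists_rat_btwn hlt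
      obtain ⟨w, hw, hwq⟩ := (hcd q).1 ⟨y, hy, h1⟩
      exact absurd (hz w hw) (not_le.2 (hwq.trans h2))
    intro c d hcd
    obtain ⟨y, hy, hy'⟩ := hmin c
    obtain ⟨z, hz, hz'⟩ := hmin d
    have := he.injective (le_antisymm (hle d c z y hz hy' fun q => (hcd q).symm)
      (hle c d y z hy hz' hcd))
    rw [← hy, ← hz, this]
  have : {x | φ (Quotient.mk F (f x)) = Quotient.mk F (g x)} =
      ⋂ q, {x | φ (Quotient.mk F (f x)) ∈ S q ↔ Quotient.mk F (g x) ∈ S q} := by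
    ext x
    simp only [Set.mem_ofPred_eq, Set.mem_iInter]
    exact ⟨fun hx q => by rw [hx], hsep _ _⟩
  rw [this]
  exact MeasurableSet.iInter fun q =>
    (((hφ.comp (hmk.comp hf)) (hS q)).mem.iff ((hmk.comp hg) (hS q)).mem).setOf

theorem not_hasInvariantProbability_of_compression [StandardBorelSpace X]
    (hρ : IsBorelCocycle E ρ) {T : ℕ → X ≃ᵐ X} (hT : Generates E T)
    (hc : HasInjectiveBorelQuotientCompression E ρ) : ¬ HasInvariantProbability E ρ := by
  classical
  rintro ⟨μ, hprob, hμ⟩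
  obtain ⟨F, h, hF, φ, hφ, hinj, hcomp⟩ := hc
  let a : X → ℝ≥0∞ := fun y => size ρ {w | F w y} y
  have ha0 : ∀ y, a y ≠ 0 := fun y =>
    size_ne_zero hρ (Set.mem_ofPred_eq ▸ F.refl y) (E.refl y)
  have hat : ∀ y, a y ≠ ∞ := fun y => size_ne_top ρ (hF.finite_fiber y) y
  have hFm : ∀ {f g : X → X}, Measurable f → Measurable g → MeasurableSet {x | F (f x) (g x)} :=
    fun hf hg => (hf.prodMk hg) hF.measurableSet
  have ham : Measurable a := by
    have : a = fun y => ∑' x : {x // E y x},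
        if F x y then ENNReal.ofReal (ρ x y) else 0 := by
      funext y
      exact (tsum_subtype_ite (q := fun x => F x y) (fun x hx => E.symm (h hx))
        (fun x => ENNReal.ofReal (ρ x y))).symm
    rw [this]
    exact hT.measurable_tsum (u := fun x y => if F x y then ENNReal.ofReal (ρ x y) else 0)
      fun f g hf hg hfg =>
        Measurable.ite (hFm hf hg) (hρ.comp hf hg hfg).ennreal_ofReal measurable_const
  -- The mass from `x` to `y`, measured relative to `y`: the share of `y` in the class `φ [x]`.
  -- Relative to `x` it is `1 / a y`, and these shares sum to `1` over that class.
  let u : X → X → ℝ≥0∞ := fun x y =>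
    if φ (Quotient.mk F x) = Quotient.mk F y then ENNReal.ofReal (ρ x y) / a y else 0
  have hu : MeasurableOn E u := fun f g hf hg hfg =>
    Measurable.ite (hF.measurableSet_graph hT h hφ hf hg)
      ((hρ.comp hf hg hfg).ennreal_ofReal.div (ham.comp hg)) measurable_const
  have hE : ∀ {x y}, φ (Quotient.mk F x) = Quotient.mk F y → E x y := fun {x y} hxy => by
    have := hcomp.graph_subset (Quotient.mk F x)
    rw [hxy] at this
    exact quotientRel_mk.1 this
  have hout : ∀ x, ∑' y : {y // E x y}, u x y * ENNReal.ofReal (ρ y x) = 1 := by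
    intro x
    obtain ⟨z, hz⟩ := Quotient.exists_rep (φ (Quotient.mk F x))
    have hxz : E x z := hE hz.symm
    have h1 : ∀ y, u x y * ENNReal.ofReal (ρ y x) =
        if F y z then ENNReal.ofReal (ρ y z) / a z else 0 := by
      intro y
      have hiff : φ (Quotient.mk F x) = Quotient.mk F y ↔ F y z := by
        rw [← hz, eq_comm]
        exact Quotient.eq
      simp only [u, hiff]
      split_ifs with hyz
      · have hEyz := h hyz
        have h2 : a z = a y * ENNReal.ofReal (ρ y z) := by
          have : {w | F w z} = {w | F w y} := by
            ext w
            exact ⟨fun hw => F.trans hw (F.symm hyz), fun hw => F.trans hw hyz⟩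
          simp only [a, this]
          exact size_change_base hρ (fun w hw => h hw) hEyz
        have h3 : ENNReal.ofReal (ρ x y) * ENNReal.ofReal (ρ y x) = 1 := by
          rw [← ENNReal.ofReal_mul (hρ.pos _ _ (hE (hiff.2 hyz))).le,
            ← hρ.mul x y x (hE (hiff.2 hyz)) (E.symm (hE (hiff.2 hyz))), hρ.self,
            ENNReal.ofReal_one]
        have h4 : ENNReal.ofReal (ρ y z) ≠ 0 := (ENNReal.ofReal_pos.2 (hρ.pos _ _ hEyz)).ne'
        rw [h2, div_eq_mul_inv, mul_right_comm, h3, one_mul]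
        simpa [eq_comm] using
          ENNReal.mul_div_mul_right 1 (a y) h4 ENNReal.ofReal_ne_top
      · simp
    simp_rw [h1]
    rw [tsum_subtype_ite (q := fun y => F y z) (fun y hy => E.trans hxz (E.symm (h hy)))
      (fun y => ENNReal.ofReal (ρ y z) / a z)]
    simp_rw [div_eq_mul_inv]
    rw [ENNReal.tsum_mul_right]
    exact ENNReal.mul_inv_cancel (ha0 z) (hat z)
  let k : X → ℝ≥0∞ := fun y => ∑' x : {x // E y x}, u x y
  have hk : ∀ y, k y = size (quotientCocycle F ρ) (φ ⁻¹' {Quotient.mk F y}) (Quotient.mk F y) := by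
    intro y
    rw [size_quotientCocycle hρ h hF hinj hcomp.graph_subset]
    simp only [k, u]
    rw [tsum_subtype_ite (q := fun x => φ (Quotient.mk F x) = Quotient.mk F y)
      (fun x hx => E.symm (hE hx)) (fun x => ENNReal.ofReal (ρ x y) / a y)]
    simp_rw [div_eq_mul_inv]
    rw [ENNReal.tsum_mul_right]
    rfl
  have hkm : Measurable k := hT.measurable_tsum hu
  have hk1 : ∀ y, k y ≤ 1 := fun y => (hk y).trans_le (hcomp.size_le _)
  have hint : ∫⁻ y, k y ∂μ = 1 := by
    have := hμ.mass_transport hρ hT hu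
    simp_rw [hout] at this
    rw [← this]
    simp
  have hae : k =ᵐ[μ] fun _ => 1 :=
    ae_eq_of_ae_le_of_lintegral_le (Filter.Eventually.of_forall hk1) (by rw [hint]; simp)
      measurable_const.aemeasurable (by rw [hint]; simp)
  have hN : μ {y | k y < 1} = 0 := by
    rw [← nonpos_iff_eq_zero, ← ae_iff.1 hae]
    exact measure_mono fun y hy => ne_of_lt hy
  have hNm : MeasurableSet {y | k y < 1} := measurableSet_lt hkm measurable_const
  -- The deficient set is null and complete; invariance makes its translates null, and they cover
  -- `X`.
  have hcover : (Set.univ : Set X) ⊆ ⋃ i, (T i).symm '' {y | k y < 1} := by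
    intro x _
    obtain ⟨c, hc, hxc⟩ := hcomp.complete (Quotient.mk F x)
    obtain ⟨y, rfl⟩ := Quotient.exists_rep c
    obtain ⟨i, hi⟩ := hT.exists_eq x y (quotientRel_mk.1 hxc)
    refine Set.mem_iUnion.2 ⟨i, y, ?_, ?_⟩
    · exact (hk y).trans_lt hc
    · rw [MeasurableEquiv.symm_apply_eq, hi]
  have : μ Set.univ = 0 := by
    refine measure_mono_null hcover (measure_iUnion_null fun i => ?_)
    rw [hμ (T i).symm (hT.rel_symm i) _ hNm]
    exact setLIntegral_measure_zero _ _ hN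
  simp at this

/-! ### Invariant measures from classes of finite size -/

/-- An automorphism inside `E` permutes the class of `z`, and `ρ(T y, y) ρ(y, z) = ρ(T y, z)` is
exactly the invariance of the atomic measure with masses `ρ(y, z)`. -/
theorem hasInvariantProbability_of_size_ne_top [StandardBorelSpace X] (hρ : IsBorelCocycle E ρ)
    {z : X} (hz : size ρ {y | E z y} z ≠ ∞) : HasInvariantProbability E ρ := by
  have hz0 : size ρ {y | E z y} z ≠ 0 :=
    size_ne_zero hρ (Set.mem_ofPred_eq ▸ E.refl z) (E.refl z)
  let ν : Measure X := Measure.sum fun y : {y | E z y} => ENNReal.ofReal (ρ y z) • Measure.dirac y.1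
  have hν : ∀ f : X → ℝ≥0∞, ∫⁻ x, f x ∂ν = ∑' y : {y | E z y}, ENNReal.ofReal (ρ y z) * f y := by
    intro f
    simp only [ν]
    rw [lintegral_sum_measure]
    refine tsum_congr fun y => ?_
    rw [lintegral_smul_measure, lintegral_dirac, smul_eq_mul]
  have hνS : ∀ S, MeasurableSet S →
      ν S = ∑' y : {y | E z y}, ENNReal.ofReal (ρ y z) * S.indicator 1 y.1 := by
    intro S hS
    rw [← hν, lintegral_indicator_one hS]
  refine ⟨(size ρ {y | E z y} z)⁻¹ • ν, ⟨?_⟩, ?_⟩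
  · rw [Measure.smul_apply, hνS _ MeasurableSet.univ, smul_eq_mul]
    simp only [Set.indicator_univ, Pi.one_apply, mul_one]
    exact ENNReal.inv_mul_cancel hz0 hz
  · intro T hT B hB
    rw [Measure.smul_apply, Measure.restrict_smul, lintegral_smul_measure]
    congr 1
    rw [hνS _ (T.measurableSet_image.2 hB), ← lintegral_indicator hB, hν]
    let σ : {y | E z y} ≃ {y | E z y} := T.toEquiv.subtypeEquiv fun y =>
      ⟨fun hy => E.trans hy (hT y), fun hy => E.trans hy (E.symm (hT y))⟩
    rw [← σ.tsum_eq]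
    refine tsum_congr fun y => ?_
    have hσ : (σ y : X) = T y := rfl
    rw [hσ]
    by_cases hy : (y : X) ∈ B
    · have hyz : E (y : X) z := E.symm y.2
      have h1 : T (y : X) ∈ T '' B := ⟨y, hy, rfl⟩
      rw [Set.indicator_of_mem h1, Set.indicator_of_mem hy, Pi.one_apply, mul_one, mul_comm,
        ← ENNReal.ofReal_mul (hρ.pos _ _ (E.symm (hT y))).le, ← hρ.mul _ _ _ (E.symm (hT y)) hyz]
    · have h1 : T (y : X) ∉ T '' B := fun ⟨w, hw, hwy⟩ => hy (T.injective hwy ▸ hw)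
      rw [Set.indicator_of_notMem h1, Set.indicator_of_notMem hy, mul_zero, mul_zero]

end CocycleInvariance

namespace CocycleInvariance

/-! ### Cutting a divergent series into increasing blocks -/

/-- Thresholds at which the partial sums of `w` more than double. -/
noncomputable def threshold (w : ℕ → ℝ≥0∞) : ℕ → ℕ
  | 0 => 0
  | k + 1 => sInf {n | 2 * ∑ i ∈ Finset.range (threshold w k), w i < ∑ i ∈ Finset.range n, w i}

/-- The index of the interval between consecutive thresholds that contains `i`. -/
noncomputable def block (w : ℕ → ℝ≥0∞) (i : ℕ) : ℕ := sInf {k | i < threshold w (k + 1)}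

section Blocks

variable {w : ℕ → ℝ≥0∞}

theorem two_mul_sum_threshold_lt (hw : ∀ i, w i ≠ ∞) (hsum : ∑' i, w i = ∞) (k : ℕ) :
    2 * ∑ i ∈ Finset.range (threshold w k), w i <
      ∑ i ∈ Finset.range (threshold w (k + 1)), w i := by
  have hne : {n | 2 * ∑ i ∈ Finset.range (threshold w k), w i <
      ∑ i ∈ Finset.range n, w i}.Nonempty := by
    have h : 2 * ∑ i ∈ Finset.range (threshold w k), w i < ∑' i, w i := by
      rw [hsum]
      exact ENNReal.mul_lt_top (by simp)
        (ENNReal.sum_lt_top.2 fun i _ => lt_top_iff_ne_top.2 (hw i))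
    rw [ENNReal.tsum_eq_iSup_nat] at h
    exact lt_iSup_iff.1 h
  exact Nat.sInf_mem hne

theorem threshold_strictMono (hw : ∀ i, w i ≠ ∞) (hsum : ∑' i, w i = ∞) :
    StrictMono (threshold w) := by
  refine strictMono_nat_of_lt_succ fun k => ?_
  by_contra! hle
  have h1 := two_mul_sum_threshold_lt hw hsum k
  have h2 : ∑ i ∈ Finset.range (threshold w (k + 1)), w i ≤
      ∑ i ∈ Finset.range (threshold w k), w i :=
    Finset.sum_le_sum_of_subset (Finset.range_mono hle)
  refine absurd (h1.trans_le h2) (not_lt.2 ?_)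
  rw [two_mul]
  exact le_self_add

theorem block_eq_iff (hw : ∀ i, w i ≠ ∞) (hsum : ∑' i, w i = ∞) {i k : ℕ} :
    block w i = k ↔ i ∈ Finset.Ico (threshold w k) (threshold w (k + 1)) := by
  have hmono := threshold_strictMono hw hsum
  have hne : {k | i < threshold w (k + 1)}.Nonempty :=
    ⟨i, (Nat.lt_succ_self i).trans_le (hmono.id_le (i + 1))⟩
  have h1 : i < threshold w (block w i + 1) := Nat.sInf_mem hne
  have h2 : threshold w (block w i) ≤ i := by
    cases hb : block w i with
    | zero => simp [threshold]
    | succ m =>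
      have : m ∉ {k | i < threshold w (k + 1)} :=
        Nat.notMem_of_lt_sInf (by rw [← block, hb]; exact Nat.lt_succ_self m)
      simpa using this
  rw [Finset.mem_Ico]
  constructor
  · rintro rfl
    exact ⟨h2, h1⟩
  · rintro ⟨h3, h4⟩
    have h5 := hmono.lt_iff_lt.1 (h2.trans_lt h4)
    have h6 := hmono.lt_iff_lt.1 (h3.trans_lt h1)
    omega

/-- Partial sums more than double between thresholds, so block `k + 1` outweighs everything before
it, in particular block `k`. -/
theorem tsum_block_lt (hw : ∀ i, w i ≠ ∞) (hsum : ∑' i, w i = ∞) (k : ℕ) :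
    (∑' i, if block w i = k then w i else 0) < ∑' i, if block w i = k + 1 then w i else 0 := by
  have hmono := threshold_strictMono hw hsum
  have key : ∀ k, (∑' i, if block w i = k then w i else 0) =
      ∑ i ∈ Finset.Ico (threshold w k) (threshold w (k + 1)), w i := by
    intro k
    rw [tsum_eq_sum (s := Finset.Ico (threshold w k) (threshold w (k + 1)))]
    · refine Finset.sum_congr rfl fun i hi => ?_
      rw [if_pos ((block_eq_iff hw hsum).2 hi)]
    · intro i hi
      rw [if_neg fun h => hi ((block_eq_iff hw hsum).1 h)]
  have hadd : ∀ k, ∑ i ∈ Finset.range (threshold w k), w i +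
      ∑ i ∈ Finset.Ico (threshold w k) (threshold w (k + 1)), w i =
      ∑ i ∈ Finset.range (threshold w (k + 1)), w i := fun k =>
    Finset.sum_range_add_sum_Ico w (hmono (Nat.lt_succ_self k)).le
  have hfin : ∑ i ∈ Finset.range (threshold w (k + 1)), w i ≠ ∞ :=
    ENNReal.sum_ne_top.2 fun i _ => hw i
  rw [key, key]
  have h1 := two_mul_sum_threshold_lt hw hsum (k + 1)
  rw [← hadd (k + 1), two_mul] at h1
  refine lt_of_le_of_lt ?_ ((ENNReal.add_lt_add_iff_left hfin).1 h1)
  rw [← hadd k]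
  exact le_add_self

end Blocks

/-! ### Borel dependence of thresholds and blocks on parameters -/

section Measurability

variable {α : Type*} [MeasurableSpace α]

theorem measurableSet_setOf_forall {p : ℕ → α → Prop} (hp : ∀ n, MeasurableSet {x | p n x}) :
    MeasurableSet {x | ∀ n, p n x} := by
  rw [show {x | ∀ n, p n x} = ⋂ n, {x | p n x} by ext x; simp]
  exact MeasurableSet.iInter hp

theorem measurable_nat_sInf {p : α → ℕ → Prop} (hp : ∀ n, MeasurableSet {x | p x n}) :
    Measurable fun x => sInf {n | p x n} := by
  classical
  -- The second alternative makes `Nat.find` return `0` when the set is empty, matching `sInf ∅ =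
  -- 0`.
  have hex : ∀ x, ∃ n, p x n ∨ ∀ m, ¬ p x m := by
    intro x
    by_cases h : ∃ n, p x n
    · exact h.imp fun n hn => Or.inl hn
    · push Not at h
      exact ⟨0, Or.inr h⟩
  have heq : (fun x => sInf {n | p x n}) = fun x => Nat.find (hex x) := by
    funext x
    by_cases h : ∃ n, p x n
    · rw [Nat.sInf_def (s := {n | p x n}) h]
      refine Nat.find_congr' fun {n} => ⟨Or.inl, fun hn => hn.resolve_right fun h' => ?_⟩
      exact h.elim fun m hm => h' m hm
    · push Not at h
      have h0 : {n | p x n} = ∅ := by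
        ext n
        simpa using h n
      rw [h0, Nat.sInf_empty, eq_comm, Nat.find_eq_zero]
      exact Or.inr h
  rw [heq]
  exact measurable_find hex fun n =>
    (hp n).union (measurableSet_setOf_forall fun m => (hp m).compl)

theorem measurable_apply_nat {β : Type*} [MeasurableSpace β] {f : ℕ → α → β}
    (hf : ∀ n, Measurable (f n)) {n : α → ℕ} (hn : Measurable n) :
    Measurable fun x => f (n x) x :=
  (measurable_from_prod_countable_right (f := fun q : ℕ × α => f q.1 q.2) hf).comp
    (hn.prodMk measurable_id)

variable {w : α → ℕ → ℝ≥0∞}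

theorem measurable_threshold (hw : ∀ i, Measurable fun x => w x i) (k : ℕ) :
    Measurable fun x => threshold (w x) k := by
  have hW : ∀ n, Measurable fun x => ∑ i ∈ Finset.range n, w x i := fun n =>
    Finset.measurable_fun_sum _ fun i _ => hw i
  induction k with
  | zero => exact measurable_const
  | succ k ih =>
    exact measurable_nat_sInf fun n =>
      measurableSet_lt ((measurable_apply_nat hW ih).const_mul 2) (hW n)

theorem measurable_block (hw : ∀ i, Measurable fun x => w x i) (i : ℕ) :
    Measurable fun x => block (w x) i :=
  measurable_nat_sInf fun k => measurableSet_lt measurable_const (measurable_threshold hw (k + 1))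

end Measurability

/-! ### Compressions -/

variable {X : Type*} [MeasurableSpace X] {E F : Setoid X} {ρ : X → X → ℝ}

/-- A Borel function respecting `F`, injective on `F`-classes and increasing their sizes, induces
an injective Borel compression of the quotient cocycle. -/
theorem hasInjectiveBorelQuotientCompression_of_map (hρ : IsBorelCocycle E ρ) (h : F ≤ E)
    (hF : IsFiniteBorel F) {Φ : X → X} (hΦ : Measurable Φ) (hΦE : ∀ x, E x (Φ x))
    (hΦF : ∀ x y, F x y ↔ F (Φ x) (Φ y))
    (hle : ∀ x, size ρ {w | F w x} x ≤ size ρ {w | F w (Φ x)} x)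
    (hlt : ∀ x, ∃ y, E x y ∧ size ρ {w | F w y} y < size ρ {w | F w (Φ y)} y) :
    HasInjectiveBorelQuotientCompression E ρ := by
  let φ : Quotient F → Quotient F := Quotient.map Φ fun x y hxy => (hΦF x y).1 hxy
  have hφmk : ∀ x, φ (Quotient.mk F x) = Quotient.mk F (Φ x) := fun x => rfl
  have hinj : Function.Injective φ := by
    intro c d hcd
    obtain ⟨x, rfl⟩ := Quotient.exists_rep c
    obtain ⟨y, rfl⟩ := Quotient.exists_rep d
    rw [hφmk, hφmk] at hcd
    exact Quotient.eq.2 ((hΦF x y).2 (Quotient.eq.1 hcd))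
  have hsize : ∀ x, size (quotientCocycle F ρ) (φ ⁻¹' {φ (Quotient.mk F x)})
      (φ (Quotient.mk F x)) = size ρ {w | F w x} x / size ρ {w | F w (Φ x)} x := by
    intro x
    have : φ ⁻¹' {φ (Quotient.mk F x)} = {Quotient.mk F x} := by
      ext c
      simp [hinj.eq_iff]
    rw [this, size_singleton, hφmk, ofReal_quotientCocycle hρ h hF (E.refl x) (E.symm (hΦE x))]
  have h0 : ∀ x, size ρ {w | F w (Φ x)} x ≠ 0 := fun x =>
    size_ne_zero hρ (Set.mem_ofPred_eq ▸ F.refl (Φ x)) (E.symm (hΦE x))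
  have htop : ∀ x, size ρ {w | F w (Φ x)} x ≠ ∞ := fun x =>
    size_ne_top ρ (hF.finite_fiber (Φ x)) x
  refine ⟨F, h, hF, φ, ?_, hinj, ?_, ?_, ?_⟩
  · exact measurable_from_quotient.2 (measurable_quotient_mk''.comp hΦ)
  · intro c
    obtain ⟨x, rfl⟩ := Quotient.exists_rep c
    exact quotientRel_mk.2 (hΦE x)
  · intro c
    by_cases hc : ∃ d, φ d = c
    · obtain ⟨d, rfl⟩ := hc
      obtain ⟨x, rfl⟩ := Quotient.exists_rep d
      rw [hsize]
      exact ENNReal.div_le_of_le_mul (by rw [one_mul]; exact hle x)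
    · have : φ ⁻¹' {c} = ∅ := by
        ext d
        simpa using fun hd => hc ⟨d, hd⟩
      rw [this]
      simp [size]
  · intro c
    obtain ⟨x, rfl⟩ := Quotient.exists_rep c
    obtain ⟨y, hxy, hy⟩ := hlt x
    refine ⟨φ (Quotient.mk F y), ?_, quotientRel_mk.2 (E.trans hxy (hΦE y))⟩
    rw [Set.mem_ofPred_eq, hsize]
    exact (ENNReal.div_lt_iff (Or.inl (h0 y)) (Or.inl (htop y))).2 (by rwa [one_mul])

/-- Take the first automorphism that carries `x` to a witness. -/
theorem Generates.exists_uniformization {T : ℕ → X ≃ᵐ X} (hT : Generates E T)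
    {P : X → X → Prop} (hP : ∀ i, MeasurableSet {x | P x (T i x)})
    (hex : ∀ x, ∃ y, E x y ∧ P x y) :
    ∃ Φ : X → X, Measurable Φ ∧ ∀ x, E x (Φ x) ∧ P x (Φ x) := by
  classical
  have hex' : ∀ x, ∃ i, P x (T i x) := by
    intro x
    obtain ⟨y, hxy, h⟩ := hex x
    obtain ⟨i, rfl⟩ := hT.exists_eq x y hxy
    exact ⟨i, h⟩
  exact ⟨fun x => T (Nat.find (hex' x)) x,
    measurable_apply_nat (fun i => (T i).measurable) (measurable_find hex' hP),
    fun x => ⟨hT.rel _ x, Nat.find_spec (hex' x)⟩⟩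

/-- The classes meeting a Borel partial transversal, if of infinite size, are cut in a Borel way
into finite blocks of increasing size. -/
theorem Generates.exists_blocks [StandardBorelSpace X] (hρ : IsBorelCocycle E ρ)
    {T : ℕ → X ≃ᵐ X} (hT : Generates E T) {Z : Set X} (hZ : MeasurableSet Z)
    (huniq : ∀ y ∈ Z, ∀ z ∈ Z, E y z → y = z) (hinf : ∀ z, size ρ {y | E z y} z = ∞) :
    ∃ K : X → ℕ, Measurable K ∧ ∀ z ∈ Z, ∀ k, {x | E z x ∧ K x = k}.Finite ∧
      size ρ {x | E z x ∧ K x = k} z < size ρ {x | E z x ∧ K x = k + 1} z := by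
  classical
  -- `e` picks the point of `Z` in the class; on classes missing `Z` its value is irrelevant.
  obtain ⟨e, he, hee⟩ := hT.exists_uniformization (P := fun x y => y ∈ Z ∨ ∀ i, T i x ∉ Z)
    (fun i => ((T i).measurable hZ).union
      (measurableSet_setOf_forall fun i => (T i).measurable hZ.compl))
    (fun x => by
      by_cases hx : ∃ i, T i x ∈ Z
      · obtain ⟨i, hi⟩ := hx
        exact ⟨_, hT.rel i x, Or.inl hi⟩
      · push Not at hx
        exact ⟨x, E.refl x, Or.inr hx⟩)
  have hez : ∀ z ∈ Z, ∀ x, E z x → e x = z := by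
    intro z hz x hzx
    obtain ⟨h1, h2⟩ := hee x
    obtain ⟨i, hi⟩ := hT.exists_eq x z (E.symm hzx)
    refine huniq _ (h2.resolve_right fun h => h i (hi ▸ hz)) z hz ?_
    exact E.symm (E.trans hzx h1)
  have hιex : ∀ x, ∃ i, T i (e x) = x := fun x => hT.exists_eq _ _ (E.symm (hee x).1)
  let ι : X → ℕ := fun x => Nat.find (hιex x)
  have hι : Measurable ι := measurable_find hιex fun i =>
    measurableSet_eq_fun ((T i).measurable.comp he) measurable_id
  have hιspec : ∀ x, T (ι x) (e x) = x := fun x => Nat.find_spec (hιex x)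
  -- For a base point `x` in `Z`, only the canonical index of each point of its class carries
  -- weight, so the series sums to the size of the class.
  let w : X → ℕ → ℝ≥0∞ := fun x i =>
    if ι (T i x) = i then ENNReal.ofReal (ρ (T i x) x) else 0
  have hw : ∀ i, Measurable fun x => w x i := fun i =>
    Measurable.ite ((hι.comp (T i).measurable) (measurableSet_singleton i))
      (hρ.comp (T i).measurable measurable_id fun x => E.symm (hT.rel i x)).ennreal_ofReal
      measurable_const
  have hwtop : ∀ x i, w x i ≠ ∞ := by
    intro x i
    simp only [w]
    split_ifs <;> simp
  let K : X → ℕ := fun x => block (w (e x)) (ι x)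
  have hK : Measurable K :=
    measurable_apply_nat (f := fun i x => block (w (e x)) i)
      (fun i => (measurable_block hw i).comp he) hι
  refine ⟨K, hK, fun z hz k => ?_⟩
  have hsz : ∀ (S : Set ℕ), size ρ {x | E z x ∧ block (w z) (ι x) ∈ S} z =
      ∑' i, if block (w z) i ∈ S then w z i else 0 := by
    intro S
    have h1 := tsum_subtype_ite (p := fun x => E z x)
      (q := fun x => E z x ∧ block (w z) (ι x) ∈ S) (fun x hx => hx.1)
      (fun x => ENNReal.ofReal (ρ x z))
    rw [size, ← h1]
    refine (tsum_class_eq (fun i => ι (T i z) = i) (fun i => T i z) (fun i _ => hT.rel i z)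
      (fun y hy => ?_) (fun i j hi hj hij => ?_)
      fun x => if E z x ∧ block (w z) (ι x) ∈ S then ENNReal.ofReal (ρ x z) else 0).trans
      (tsum_congr fun i => ?_)
    · have h2 : T (ι y) z = y := by
        conv_lhs => rw [← hez z hz y hy]
        exact hιspec y
      exact ⟨ι y, by rw [h2], h2⟩
    · rw [← hi, ← hj, hij]
    · simp only [w]
      by_cases hi : ι (T i z) = i
      · simp [hi, hT.rel i z]
      · simp [hi]
  have hsum : ∑' i, w z i = ∞ := by
    have := hsz Set.univ
    simp only [Set.mem_univ, and_true, if_true] at this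
    rw [← this]
    exact hinf z
  have hKset : ∀ k, {x | E z x ∧ K x = k} = {x | E z x ∧ block (w z) (ι x) ∈ ({k} : Set ℕ)} := by
    intro k
    ext x
    simp only [Set.mem_ofPred_eq, Set.mem_singleton_iff]
    refine and_congr_right fun hx => ?_
    simp only [K, hez z hz x hx]
  constructor
  · refine Set.Finite.subset ((Finset.finite_toSet (Finset.Ico (threshold (w z) k)
      (threshold (w z) (k + 1)))).image fun i => T i z) ?_
    rw [hKset]
    rintro x ⟨hx, hxk⟩
    refine ⟨ι x, (block_eq_iff (hwtop z) hsum).1 hxk, ?_⟩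
    have := hιspec x
    rwa [hez z hz x hx] at this
  · rw [hKset, hKset, hsz, hsz]
    simp only [Set.mem_singleton_iff]
    convert tsum_block_lt (hwtop z) hsum k

/-- A smooth cocycle admits a lacunary complete Borel set. -/
theorem exists_lacunary_complete (hρ : IsBorelCocycle E ρ) (hs : IsSmooth E ρ)
    {T : ℕ → X ≃ᵐ X} (hT : Generates E T) :
    ∃ Y : Set X, MeasurableSet Y ∧ IsComplete E Y ∧
      ∃ δ > 0, ∀ x ∈ Y, ∀ y ∈ Y, E x y → x ≠ y → δ ≤ |Real.log (ρ x y)| := by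
  obtain ⟨c, hc, δ, hδ, hgap⟩ := hs.exists_gap hρ
  -- Keep the points of least colour in their class: equivalent ones share a colour, so the gap
  -- applies to them.
  refine ⟨{x | ∀ i, c x ≤ c (T i x)}, measurableSet_setOf_forall fun i =>
    measurableSet_le hc (hc.comp (T i).measurable), fun x => ?_, δ, hδ, fun x hx y hy hxy => ?_⟩
  · obtain ⟨y, hy, hmin⟩ := (measure c).wf.has_min {y | E x y} ⟨x, E.refl x⟩
    exact ⟨y, fun i => not_lt.1 (hmin _ (E.trans hy (hT.rel i y))), hy⟩
  · refine hgap x y hxy (le_antisymm ?_ ?_)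
    · obtain ⟨i, rfl⟩ := hT.exists_eq x y hxy
      exact hx i
    · obtain ⟨i, rfl⟩ := hT.exists_eq y x (E.symm hxy)
      exact hy i

/-- A point of a lacunary set below some other point of the set has a successor in the set. -/
theorem exists_successor (hρ : IsBorelCocycle E ρ) {Y : Set X} {δ : ℝ} (hδ : 0 < δ)
    (hgap : ∀ x ∈ Y, ∀ y ∈ Y, E x y → x ≠ y → δ ≤ |Real.log (ρ x y)|) {x : X}
    (hx : ∃ y, E x y ∧ y ∈ Y ∧ 1 < ρ y x) :
    ∃ y, E x y ∧ y ∈ Y ∧ 1 < ρ y x ∧ ∀ z, E x z → z ∈ Y → 1 < ρ z x → ρ y x ≤ ρ z x := by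
  let S : Set ℝ := {l | ∃ y, (E x y ∧ y ∈ Y ∧ 1 < ρ y x) ∧ Real.log (ρ y x) = l}
  have hSne : S.Nonempty := by
    obtain ⟨y, hy⟩ := hx
    exact ⟨_, y, hy, rfl⟩
  have hSbdd : BddBelow S := by
    refine ⟨0, ?_⟩
    rintro _ ⟨y, hy, rfl⟩
    exact Real.log_nonneg hy.2.2.le
  -- A value within `δ` of the infimum is already the minimum: a smaller one would lie less than `δ`
  -- below it.
  obtain ⟨_, ⟨y, hy, rfl⟩, hylt⟩ := exists_lt_of_csInf_lt hSne (lt_add_of_pos_right (sInf S) hδ)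
  refine ⟨y, hy.1, hy.2.1, hy.2.2, fun z hxz hz h1 => ?_⟩
  by_contra! hlt
  have hzpos : 0 < ρ z x := by linarith
  have hypos : 0 < ρ y x := by linarith
  have hlog := Real.log_lt_log hzpos hlt
  have hinf : sInf S ≤ Real.log (ρ z x) := csInf_le hSbdd ⟨z, ⟨hxz, hz, h1⟩, rfl⟩
  have hyz : E y z := E.trans (E.symm hy.1) hxz
  have hne : y ≠ z := by
    rintro rfl
    exact lt_irrefl _ hlt
  have h2 := hgap y hy.2.1 z hz hyz hne
  have h3 : Real.log (ρ y x) = Real.log (ρ y z) + Real.log (ρ z x) := by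
    rw [hρ.mul y z x hyz (E.symm hxz), Real.log_mul (hρ.pos _ _ hyz).ne' hzpos.ne']
  rw [abs_of_pos (by linarith)] at h2
  linarith

theorem hasInjectiveBorelQuotientCompression_of_size_eq_top [StandardBorelSpace X]
    (hE : IsCountableBorel E) (hρ : IsBorelCocycle E ρ) (hs : IsSmooth E ρ) {T : ℕ → X ≃ᵐ X}
    (hT : Generates E T) (hinf : ∀ z, size ρ {y | E z y} z = ∞) :
    HasInjectiveBorelQuotientCompression E ρ := by
  obtain ⟨Y, hY, hYc, δ, hδ, hgap⟩ := exists_lacunary_complete hρ hs hT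
  have hρT' : ∀ i, Measurable fun x => ρ (T i x) x := fun i =>
    hρ.comp (T i).measurable measurable_id fun x => E.symm (hT.rel i x)
  -- The `ρ`-largest points of `Y` in their class. Two of them would satisfy `ρ = 1`, against the
  -- gap.
  let Z : Set X := {y | y ∈ Y ∧ ∀ i, T i y ∈ Y → ρ (T i y) y ≤ 1}
  have hZm : MeasurableSet Z := hY.inter (measurableSet_setOf_forall fun i =>
    (((T i).measurable hY).mem.imp (measurableSet_le (hρT' i) measurable_const).mem).setOf)
  have hZle : ∀ y ∈ Z, ∀ z ∈ Y, E y z → ρ z y ≤ 1 := by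
    rintro y hy z hz hyz
    obtain ⟨i, rfl⟩ := hT.exists_eq y z hyz
    exact hy.2 i hz
  have huniq : ∀ y ∈ Z, ∀ z ∈ Z, E y z → y = z := by
    intro y hy z hz hyz
    by_contra hne
    have h1 := hZle y hy z hz.1 hyz
    have h2 := hZle z hz y hy.1 (E.symm hyz)
    have h3 : ρ y z = 1 := by
      refine le_antisymm h2 ?_
      rw [hρ.inv hyz] at h1
      exact (inv_le_one₀ (hρ.pos _ _ hyz)).1 h1
    have h4 := hgap y hy.1 z hz.1 hyz hne
    rw [h3, Real.log_one, abs_zero] at h4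
    linarith
  obtain ⟨K, hK, hKblock⟩ := hT.exists_blocks hρ hZm huniq hinf
  let B : Set X := {x | ∃ y, E x y ∧ y ∈ Z}
  have hB : MeasurableSet B := hT.measurableSet_exists fun i => (T i).measurable hZm
  have hBE : ∀ {x y}, E x y → x ∈ B → y ∈ B := by
    rintro x y hxy ⟨z, hxz, hz⟩
    exact ⟨z, E.trans (E.symm hxy) hxz, hz⟩
  -- Off `B`, every point of `Y` has a successor.
  have hsucc : ∀ x ∉ B, x ∈ Y → ∃ y, E x y ∧ y ∈ Y ∧ 1 < ρ y x ∧
      ∀ z, E x z → z ∈ Y → 1 < ρ z x → ρ y x ≤ ρ z x := by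
    intro x hxB hxY
    refine exists_successor hρ hδ hgap ?_
    by_contra! hno
    exact hxB ⟨x, E.refl x, hxY, fun i hi => hno _ (hT.rel i x) hi⟩
  -- Blocks of classes inside `B`, compared at an arbitrary point.
  have hblock : ∀ x ∈ B, ∀ k, {w | E x w ∧ K w = k}.Finite ∧
      size ρ {w | E x w ∧ K w = k} x < size ρ {w | E x w ∧ K w = k + 1} x := by
    rintro x ⟨z, hxz, hz⟩ k
    obtain ⟨h1, h2⟩ := hKblock z hz k
    have hset : ∀ k, {w | E x w ∧ K w = k} = {w | E z w ∧ K w = k} := by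
      intro k
      ext w
      exact and_congr_left fun _ => ⟨E.trans (E.symm hxz), E.trans hxz⟩
    have hzx := E.symm hxz
    have hsz : ∀ k, size ρ {w | E z w ∧ K w = k} x =
        size ρ {w | E z w ∧ K w = k} z * ENNReal.ofReal (ρ z x) := fun k =>
      size_change_base hρ (fun w hw => E.symm hw.1) hzx
    rw [hset, hset, hsz, hsz]
    exact ⟨h1, ENNReal.mul_lt_mul_left
      (ENNReal.ofReal_pos.2 (hρ.pos _ _ hzx)).ne' ENNReal.ofReal_ne_top h2⟩
  let F : Setoid X :=
    { r := fun x y => x = y ∨ x ∈ B ∧ E x y ∧ K x = K y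
      iseqv :=
        { refl := fun x => Or.inl rfl
          symm := by
            rintro x y (rfl | ⟨h1, h2, h3⟩)
            · exact Or.inl rfl
            · exact Or.inr ⟨hBE h2 h1, E.symm h2, h3.symm⟩
          trans := by
            rintro x y z (rfl | ⟨h1, h2, h3⟩) (rfl | ⟨h4, h5, h6⟩)
            · exact Or.inl rfl
            · exact Or.inr ⟨h4, h5, h6⟩
            · exact Or.inr ⟨h1, h2, h3⟩
            · exact Or.inr ⟨h1, E.trans h2 h5, h3.trans h6⟩ } }
  have hFdef : ∀ x y, F x y ↔ x = y ∨ x ∈ B ∧ E x y ∧ K x = K y := fun x y => Iff.rfl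
  have hFB : ∀ x ∈ B, ∀ y, F y x ↔ E x y ∧ K y = K x := by
    intro x hx y
    rw [hFdef]
    constructor
    · rintro (rfl | ⟨-, h2, h3⟩)
      exacts [⟨E.refl y, rfl⟩, ⟨E.symm h2, h3⟩]
    · rintro ⟨h1, h2⟩
      exact Or.inr ⟨hBE h1 hx, E.symm h1, h2⟩
  have hFA : ∀ x ∉ B, ∀ y, F y x ↔ y = x := by
    intro x hx y
    rw [hFdef]
    refine ⟨?_, Or.inl⟩
    rintro (rfl | ⟨h1, h2, -⟩)
    exacts [rfl, absurd (hBE h2 h1) hx]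
  have hFsetB : ∀ x ∈ B, {w | F w x} = {w | E x w ∧ K w = K x} := fun x hx => by
    ext w
    exact hFB x hx w
  have hFsetA : ∀ x ∉ B, {w | F w x} = {x} := fun x hx => by
    ext w
    exact hFA x hx w
  have hFE : F ≤ E := by
    rintro x y (rfl | ⟨-, h, -⟩)
    exacts [E.refl x, h]
  have hF : IsFiniteBorel F := by
    refine ⟨?_, fun x => ?_⟩
    · have : {p : X × X | F p.1 p.2} = {p | p.1 = p.2} ∪
          (Prod.fst ⁻¹' B ∩ ({p | E p.1 p.2} ∩ {p | K p.1 = K p.2})) := rfl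
      rw [this]
      exact (measurableSet_eq_fun measurable_fst measurable_snd).union
        ((measurable_fst hB).inter (hE.measurableSet.inter
          (measurableSet_eq_fun (hK.comp measurable_fst) (hK.comp measurable_snd))))
    · have : {y | F x y} = {y | F y x} := by
        ext y
        exact ⟨F.symm, F.symm⟩
      rw [this]
      by_cases hx : x ∈ B
      · rw [hFsetB x hx]
        exact (hblock x hx _).1
      · rw [hFsetA x hx]
        exact Set.finite_singleton x
  -- The graph to be uniformized: next block on `B`; off `B`, the identity outside `Y` and the
  -- successor on `Y`. On `B` any point of the next block will do, since only its `F`-class matters.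
  let P : X → X → Prop := fun x y =>
    (x ∈ B ∧ K y = K x + 1) ∨ (x ∉ B ∧ x ∉ Y ∧ y = x) ∨
      (x ∉ B ∧ x ∈ Y ∧ y ∈ Y ∧ 1 < ρ y x ∧ ∀ j, T j x ∈ Y → 1 < ρ (T j x) x → ρ y x ≤ ρ (T j x) x)
  obtain ⟨Φ, hΦ, hΦP⟩ := hT.exists_uniformization (P := P) (by
    intro i
    refine MeasurableSet.union ?_ (MeasurableSet.union ?_ ?_)
    · exact hB.inter (measurableSet_eq_fun (hK.comp (T i).measurable) (hK.add_const 1))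
    · exact hB.compl.inter (hY.compl.inter (measurableSet_eq_fun (T i).measurable measurable_id))
    · refine hB.compl.inter (hY.inter (((T i).measurable hY).inter
        ((measurableSet_lt measurable_const (hρT' i)).inter
          (measurableSet_setOf_forall fun j => ?_))))
      exact (((T j).measurable hY).mem.imp
        ((measurableSet_lt measurable_const (hρT' j)).mem.imp
          (measurableSet_le (hρT' i) (hρT' j)).mem)).setOf)
    (by
      intro x
      by_cases hx : x ∈ B
      · have h0 : size ρ {w | E x w ∧ K w = K x + 1} x ≠ 0 :=
          (lt_of_le_of_lt (zero_le) (hblock x hx (K x)).2).ne'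
        have hne : {w | E x w ∧ K w = K x + 1}.Nonempty := by
          by_contra hem
          rw [Set.not_nonempty_iff_eq_empty] at hem
          rw [hem] at h0
          simp [size] at h0
        obtain ⟨y, hxy, hy⟩ := hne
        exact ⟨y, hxy, Or.inl ⟨hx, hy⟩⟩
      · by_cases hxY : x ∈ Y
        · obtain ⟨y, hxy, hy, h1, h2⟩ := hsucc x hx hxY
          exact ⟨y, hxy, Or.inr (Or.inr ⟨hx, hxY, hy, h1, fun j => h2 _ (hT.rel j x)⟩)⟩
        · exact ⟨x, E.refl x, Or.inr (Or.inl ⟨hx, hxY, rfl⟩)⟩)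
  have hΦE : ∀ x, E x (Φ x) := fun x => (hΦP x).1
  have hΦB : ∀ x ∈ B, K (Φ x) = K x + 1 := by
    intro x hx
    rcases (hΦP x).2 with h | h | h
    exacts [h.2, absurd hx h.1, absurd hx h.1]
  have hΦid : ∀ x ∉ B, x ∉ Y → Φ x = x := by
    intro x hx hxY
    rcases (hΦP x).2 with h | h | h
    exacts [absurd h.1 hx, h.2.2, absurd h.2.1 hxY]
  have hΦY : ∀ x ∉ B, x ∈ Y → Φ x ∈ Y ∧ 1 < ρ (Φ x) x ∧
      ∀ z, E x z → z ∈ Y → 1 < ρ z x → ρ (Φ x) x ≤ ρ z x := by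
    intro x hx hxY
    rcases (hΦP x).2 with h | h | h
    · exact absurd h.1 hx
    · exact absurd hxY h.2.1
    · refine ⟨h.2.2.1, h.2.2.2.1, fun z hz => ?_⟩
      obtain ⟨j, rfl⟩ := hT.exists_eq x z hz
      exact h.2.2.2.2 j
  have hΦmemY : ∀ x ∉ B, (Φ x ∈ Y ↔ x ∈ Y) := by
    intro x hx
    by_cases hxY : x ∈ Y
    · exact iff_of_true (hΦY x hx hxY).1 hxY
    · rw [hΦid x hx hxY]
  have hΦBmem : ∀ {x}, x ∈ B ↔ Φ x ∈ B := fun {x} =>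
    ⟨hBE (hΦE x), hBE (E.symm (hΦE x))⟩
  -- A point strictly above `x` is at least the successor of `x`.
  have hnot : ∀ x ∉ B, ∀ y, x ∈ Y → y ∈ Y → E x y → Φ x = Φ y → y ∉ B → ¬ 1 < ρ y x := by
    intro x hx y hxY hyY hxy heq hy hlt
    have h1 := (hΦY x hx hxY).2.2 y hxy hyY hlt
    have h2 := (hΦY y hy hyY).2.1
    rw [heq, hρ.mul _ y x (E.symm (hΦE y)) (E.symm hxy)] at h1
    nlinarith [hρ.pos y x (E.symm hxy)]
  -- Of two points of `Y` with a common successor neither lies above the other, so `ρ = 1` between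
  -- them and lacunarity makes them equal.
  have hΦinj : ∀ x ∉ B, ∀ y ∉ B, Φ x = Φ y → x = y := by
    intro x hx y hy heq
    by_cases hxY : x ∈ Y
    · have hyY : y ∈ Y := (hΦmemY y hy).1 (heq ▸ (hΦmemY x hx).2 hxY)
      by_contra hne
      have hxy : E x y := E.trans (hΦE x) (heq ▸ E.symm (hΦE y))
      have h1 := hnot x hx y hxY hyY hxy heq hy
      have h2 := hnot y hy x hyY hxY (E.symm hxy) heq.symm hx
      have h3 : ρ y x = 1 := by
        refine le_antisymm (not_lt.1 h1) ?_
        rw [hρ.inv (E.symm hxy)] at h2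
        by_contra! h4
        exact h2 ((one_lt_inv₀ (hρ.pos _ _ (E.symm hxy))).2 h4)
      have h4 := hgap y hyY x hxY (E.symm hxy) (Ne.symm hne)
      rw [h3, Real.log_one, abs_zero] at h4
      linarith
    · have hyY : y ∉ Y := fun h => hxY ((hΦmemY x hx).1 (heq ▸ (hΦmemY y hy).2 h))
      rwa [hΦid x hx hxY, hΦid y hy hyY] at heq
  have hltB : ∀ x ∈ B, size ρ {w | F w x} x < size ρ {w | F w (Φ x)} x := by
    intro x hx
    have : {w | E (Φ x) w ∧ K w = K (Φ x)} = {w | E x w ∧ K w = K x + 1} := by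
      ext w
      rw [Set.mem_ofPred_eq, Set.mem_ofPred_eq, hΦB x hx]
      exact and_congr_left fun _ => ⟨E.trans (hΦE x), E.trans (E.symm (hΦE x))⟩
    rw [hFsetB x hx, hFsetB _ (hΦBmem.1 hx), this]
    exact (hblock x hx _).2
  have hsizeA : ∀ x ∉ B, size ρ {w | F w x} x = 1 ∧
      size ρ {w | F w (Φ x)} x = ENNReal.ofReal (ρ (Φ x) x) := by
    intro x hx
    rw [hFsetA x hx, hFsetA _ (fun h => hx (hΦBmem.2 h)), size_singleton, size_singleton, hρ.self,
      ENNReal.ofReal_one]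
    exact ⟨rfl, rfl⟩
  have hltA : ∀ x ∉ B, x ∈ Y → size ρ {w | F w x} x < size ρ {w | F w (Φ x)} x := by
    intro x hx hxY
    rw [(hsizeA x hx).1, (hsizeA x hx).2, ← ENNReal.ofReal_one]
    exact (ENNReal.ofReal_lt_ofReal_iff (by linarith [(hΦY x hx hxY).2.1])).2 (hΦY x hx hxY).2.1
  refine hasInjectiveBorelQuotientCompression_of_map hρ hFE hF hΦ hΦE ?_ ?_ ?_
  · intro x y
    by_cases hy : y ∈ B
    · rw [hFB y hy, hFB _ (hΦBmem.1 hy)]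
      constructor
      · rintro ⟨h1, h2⟩
        refine ⟨E.trans (E.symm (hΦE y)) (E.trans h1 (hΦE x)), ?_⟩
        rw [hΦB x (hBE h1 hy), hΦB y hy, h2]
      · rintro ⟨h1, h2⟩
        have hyx : E y x := E.trans (hΦE y) (E.trans h1 (E.symm (hΦE x)))
        rw [hΦB x (hBE hyx hy), hΦB y hy] at h2
        exact ⟨hyx, Nat.succ_injective h2⟩
    · have hy' : Φ y ∉ B := fun h => hy (hΦBmem.2 h)
      rw [hFA y hy, hFA _ hy']
      refine ⟨fun h => h ▸ rfl, fun h => hΦinj x (fun hx => hy' ?_) y hy h⟩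
      rw [← h]
      exact hΦBmem.1 hx
  · intro x
    by_cases hx : x ∈ B
    · exact (hltB x hx).le
    · by_cases hxY : x ∈ Y
      · exact (hltA x hx hxY).le
      · rw [hΦid x hx hxY]
  -- Every point of `B` and every point of `Y` gains size strictly, so completeness of `Y` supplies
  -- the required point in each class.
  · intro x
    obtain ⟨y, hyY, hxy⟩ := hYc x
    by_cases hy : y ∈ B
    · exact ⟨y, hxy, hltB y hy⟩
    · exact ⟨y, hxy, hltA y hy hyY⟩

end CocycleInvariance

theorem mainTheorem5 {X : Type*} [MeasurableSpace X] [StandardBorelSpace X]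
    (E : Setoid X) (hE : CocycleInvariance.IsCountableBorel E)
    (ρ : X → X → ℝ) (hρ : CocycleInvariance.IsBorelCocycle E ρ)
    (hsmooth : CocycleInvariance.IsSmooth E ρ) :
    (CocycleInvariance.HasInjectiveBorelQuotientCompression E ρ ∨
        CocycleInvariance.HasInvariantProbability E ρ) ∧
      ¬ (CocycleInvariance.HasInjectiveBorelQuotientCompression E ρ ∧
        CocycleInvariance.HasInvariantProbability E ρ) := by
  obtain ⟨T, hTE, hTex⟩ := CocycleInvariance.exists_measurableEquiv_enumeration hE hρ hsmooth
  have hT : CocycleInvariance.Generates E T := ⟨hTE, hTex⟩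
  refine ⟨?_, fun h =>
    CocycleInvariance.not_hasInvariantProbability_of_compression hρ hT h.1 h.2⟩
  by_cases hinf : ∀ z, CocycleInvariance.size ρ {y | E z y} z = ∞
  · exact Or.inl (CocycleInvariance.hasInjectiveBorelQuotientCompression_of_size_eq_top
      hE hρ hsmooth hT hinf)
  · push Not at hinf
    obtain ⟨z, hz⟩ := hinf
    exact Or.inr (CocycleInvariance.hasInvariantProbability_of_size_ne_top hρ hz)
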